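/- Let $(X,\mathcal A,\mu)$ be a $\sigma$-finite measure space, and let $T:X\to X$ be a conservative, ergodic, measure-preserving transformation. Let $d\ge 2$ and let $X=Y\cup\bigcup_{i=1}^d A_i$, where $Y,A_1,\dots,A_d\in\mathcal A$ are pairwise disjoint, $0<\mu(Y)<\infty$, $\mu(A_i)=\infty$ for all $i$, and $A_i\cap T^{-1}A_j=\emptyset$ whenever $i\ne j$. Notation. $\hat T$ denotes the transfer operator on non-negative measurable functions, $\hat Tu=d(\mu_u\circ T^{-1})/d\mu$, where $\mu_u(B)=\int_B u\,d\mu$. Put $Y_0=Y$, $Y_n=T^{-n}Y\setminus\bigcup_{k=0}^{n-1}T^{-k}Y$ $(n\ge1)$, $w_n^{Y,A_i}=\mu\big(\bigcup_{k=0}^{n-1}(T^{-k}Y)\cap A_i\big)$ and $S_n^{A}(x)=\sum_{k=1}^n 1_A(T^kx)$. A family $\mathfrak H$ of non-negative measurable functions is called uniformly sweeping for a non-negative measurable function $F$ if there are $C>0$ and an integer $K\ge0$ such that $C\sum_{k=0}^K\hat T^kH\ge F$ $\mu$-a.e. for every $H\in\mathfrak H$; a function $H$ is called uniformly sweeping for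 $F$ if $\{H\}$ is. Assume moreover: (a) there are $\alpha,\beta_1,\dots,\beta_d\in(0,1)$ with $\sum_{i=1}^d\beta_i=1$ and a measurable function $\ell:(0,\infty)\to(0,\infty)$, slowly varying at $\infty$ (that is, $\ell(at)/\ell(t)\to1$ as $t\to\infty$ for every $a>0$), such that $w_n^{Y,A_i}\sim\beta_i n^{1-\alpha}\ell(n)$ as $n\to\infty$ for $i=1,\dots,d$; (b) the family $\Big\{\frac1{w_n^{Y,A_d}}\sum_{k=0}^{n-1}\hat T^k1_{Y_k\cap A_d}\Big\}_{n\ge2}$ is bounded in $L^\infty(\mu)$; (c) there is $N\ge2$ such that the family $\Big\{\frac1{w_n^{Y,A_i}}\sum_{k=0}^{n-1}\hat T^k1_{Y_k\cap A_i}\Big\}_{n\ge N,\ 1\le i\le d-1}$ is uniformly sweeping for $1_Y$. Let $G\in L^1(\mu)$ with $G\ge0$, let $1_Y$ be uniformly sweeping for $G$, and let $\lambda_1,\dots,\lambda_{d-1}\in(0,\infty)$. Then there is a constant $C_2\in(0,\infty)$ such that, for every sequence $\{c(n)\}_{n\ge0}$ of positive numbers with $c(n)\to0$ and $c(n)n\to\infty$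 as $n\to\infty$, $$\limsup_{n\to\infty}\frac{\ell(c(n)n)}{c(n)^\alpha\,\ell(n)}\;\mu_G\Big(\frac1n\sum_{i=1}^{d-1}\lambda_iS_n^{A_i}\le c(n)\Big)\le C_2 .$$ -/

import Mathlib

open MeasureTheory Filter Set
open scoped Topology ENNReal Asymptotics

noncomputable section

/-- A positive, measurable function on `(0, ∞)` which is slowly varying at `∞`
(the values of `ℓ` outside `(0, ∞)` are irrelevant). -/
structure IsSlowlyVarying (ℓ : ℝ → ℝ) : Prop where
  pos : ∀ t : ℝ, 0 < t → 0 < ℓ t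
  measurable : Measurable (fun t : Ioi (0 : ℝ) => ℓ t)
  tendsto_ratio : ∀ a : ℝ, 0 < a → Tendsto (fun t : ℝ => ℓ (a * t) / ℓ t) atTop (𝓝 1)

variable {X : Type*}

/-- The set `Y_n` of points whose orbit visits `Y` for the first time (time `0` included)
at time `n`. In particular `Y_0 = Y`. -/
def firstVisit (T : X → X) (Y : Set X) (n : ℕ) : Set X :=
  (T^[n] ⁻¹' Y) \ ⋃ k ∈ Finset.range n, T^[k] ⁻¹' Y

/-- The occupation time `S_n^A(x)` on `A` of the orbit of `x` from time `1` to time `n`. -/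
def occupationTime (T : X → X) (A : Set X) (n : ℕ) (x : X) : ℝ :=
  ∑ k ∈ Finset.Icc 1 n, A.indicator (fun _ => (1 : ℝ)) (T^[k] x)

/-- `Y` dynamically separates the sets `A i` under the action of `T`. -/
def DynamicallySeparates {ι : Type*} (T : X → X) (A : ι → Set X) : Prop :=
  ∀ i j, i ≠ j → A i ∩ T ⁻¹' A j = ∅

variable [MeasurableSpace X]

/-- The transfer operator of `T` on nonnegative functions: the density with respect to `μ` of the
image under `T` of the measure with density `u`. -/
def transferOperator (T : X → X) (μ : Measure X) (u : X → ℝ≥0∞) : X → ℝ≥0∞ :=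
  ((μ.withDensity u).map T).rnDeriv μ

/-- The wandering rate `μ(⋃_{k < n} T^{-k} Y ∩ A)` of `Y` starting from `A`. -/
def wanderingRate (T : X → X) (μ : Measure X) (Y A : Set X) (n : ℕ) : ℝ≥0∞ :=
  μ (⋃ k ∈ Finset.range n, (T^[k] ⁻¹' Y) ∩ A)

/-- The normalised sums `(1 / w_n^{Y,A}) ∑_{k < n} T̂^k 1_{Y_k ∩ A}`. -/
def entranceAverage (T : X → X) (μ : Measure X) (Y A : Set X) (n : ℕ) (x : X) : ℝ≥0∞ :=
  (wanderingRate T μ Y A n)⁻¹ *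
    ∑ k ∈ Finset.range n,
      (transferOperator T μ)^[k] ((firstVisit T Y k ∩ A).indicator (fun _ => 1)) x

/-- The family `𝓗` of nonnegative functions is uniformly sweeping for `G`. -/
def UniformlySweeping (T : X → X) (μ : Measure X) (𝓗 : Set (X → ℝ≥0∞)) (G : X → ℝ≥0∞) : Prop :=
  ∃ C : ℝ, 0 < C ∧ ∃ K : ℕ, ∀ H ∈ 𝓗, ∀ᵐ x ∂μ,
    G x ≤ ENNReal.ofReal C * ∑ k ∈ Finset.range (K + 1), (transferOperator T μ)^[k] H x

end

/-! Let `B` be the union of all the `A i` except the last. By separation, an orbit can leave `B`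
only through `Y`. If `δ` is the smallest weight, the event in question forces at most `p =
⌊c(n)n/δ⌋` visits to `B`.

Two estimates carry the proof. The sweeping hypotheses (`exists_withDensity_visits_le`) replace
`μ_G` by `μ` on `B`: the two sweepings and an entrance time below `q = ⌊c(n)n⌋` shift the orbit by
at most `K + q` steps, hence raise the count by at most `K + q`, while the average contributes the
factor `1 / w_q`. A double count over pairs of times (`sub_mul_measure_visits_le`), which needs only
invariance of `μ`, bounds the measure of the points of `B` with at most `p'` visits by `(p' + 1) /
(n - p')` times the measure of the points reaching `Y` by time `n`.

With `p' = p + K + q` of order `c(n)n`, the product is of order `c(n) · n^(1-α) ℓ(n) /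
((c(n)n)^(1-α) ℓ(c(n)n))`, which equals `c(n)^α ℓ(n) / ℓ(c(n)n)`. Slow variation is otherwise needed
only to replace `c(n)n` by its integer part. -/

/-! ### Slowly varying functions -/

namespace IsSlowlyVarying

/-- Uniform convergence for slowly varying functions, along sequences and in the form of a bound. -/
theorem eventually_abs_log_sub_le {ℓ : ℝ → ℝ} (hℓ : IsSlowlyVarying ℓ) {x u : ℕ → ℝ}
    (hx : Tendsto x atTop atTop) (hu : ∀ᶠ n in atTop, u n ∈ Icc (0 : ℝ) 1) :
    ∀ᶠ n in atTop, |Real.log (ℓ (Real.exp (x n + u n))) - Real.log (ℓ (Real.exp (x n)))| ≤ 1 := by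
  set h : ℝ → ℝ := fun y => Real.log (ℓ (Real.exp y)) with hh
  have hmeas : Measurable h := by
    have h1 : Measurable fun y : ℝ => (⟨Real.exp y, Real.exp_pos y⟩ : Ioi (0 : ℝ)) :=
      Real.measurable_exp.subtype_mk
    exact Real.measurable_log.comp (hℓ.measurable.comp h1)
  have hlim : ∀ v : ℝ, Tendsto (fun y => h (y + v) - h y) atTop (𝓝 0) := by
    intro v
    have h1 := (hℓ.tendsto_ratio (Real.exp v) (Real.exp_pos v)).comp Real.tendsto_exp_atTop
    have h2 := h1.log one_ne_zero
    rw [Real.log_one] at h2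
    refine h2.congr fun y => ?_
    simp only [Function.comp, hh]
    rw [Real.log_div (hℓ.pos _ (by positivity)).ne' (hℓ.pos _ (by positivity)).ne', Real.exp_add,
      mul_comm]
  -- Pointwise convergence on an interval of finite length gives convergence in measure, so the bad
  -- increments eventually have measure below `1/2`.
  have key : ∀ y : ℕ → ℝ, Tendsto y atTop atTop → ∀ᶠ n in atTop,
      volume ({v | 1 / 3 ≤ |h (y n + v) - h (y n)|} ∩ Icc (0 : ℝ) 3) < ENNReal.ofReal (1 / 2) := by
    intro y hy
    have h1 : TendstoInMeasure (volume.restrict (Icc (0 : ℝ) 3))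
        (fun n v => h (y n + v) - h (y n)) atTop (fun _ => (0 : ℝ)) := by
      refine tendstoInMeasure_of_tendsto_ae (fun n => ?_) (ae_of_all _ fun v => (hlim v).comp hy)
      exact ((hmeas.comp (measurable_const.add measurable_id)).sub
        measurable_const).aestronglyMeasurable
    have h2 := (tendstoInMeasure_iff_norm.1 h1 (1 / 3) (by norm_num)).eventually_lt_const
      (show (0 : ℝ≥0∞) < ENNReal.ofReal (1 / 2) by simp)
    filter_upwards [h2] with n hn
    rw [Measure.restrict_apply' measurableSet_Icc] at hn
    simpa only [sub_zero, Real.norm_eq_abs] using hn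
  have hxu : Tendsto (fun n => x n + u n) atTop atTop :=
    tendsto_atTop_mono' _ (hu.mono fun n hn => by linarith [hn.1]) hx
  filter_upwards [key x hx, key _ hxu, hu] with n h1 h2 hn
  set b₁ := {v | 1 / 3 ≤ |h (x n + v) - h (x n)|} ∩ Icc (0 : ℝ) 3
  set b₂ := {v | 1 / 3 ≤ |h (x n + u n + v) - h (x n + u n)|} ∩ Icc (0 : ℝ) 3
  -- The bad sets at `x n` and at `x n + u n`, moved to a common origin, cannot cover `[1, 2]`; a
  -- remaining `v` links both base points to `x n + v`.
  have hb : volume (b₁ ∪ (fun v => v + -u n) ⁻¹' b₂) < volume (Icc (1 : ℝ) 2) := by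
    refine (measure_union_le _ _).trans_lt ?_
    rw [measure_preimage_add_right, Real.volume_Icc,
      show (2 - 1 : ℝ) = 1 / 2 + 1 / 2 by norm_num, ENNReal.ofReal_add (by norm_num) (by norm_num)]
    exact ENNReal.add_lt_add h1 h2
  obtain ⟨v, hv, hvb⟩ : ∃ v ∈ Icc (1 : ℝ) 2, v ∉ b₁ ∪ (fun v => v + -u n) ⁻¹' b₂ := by
    by_contra! hcon
    exact hb.not_ge (measure_mono hcon)
  obtain ⟨hv1, hv2⟩ := not_or.1 hvb
  have h3 : |h (x n + v) - h (x n)| < 1 / 3 := by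
    by_contra! hc
    exact hv1 ⟨hc, by linarith [hv.1], by linarith [hv.2]⟩
  have h4 : |h (x n + v) - h (x n + u n)| < 1 / 3 := by
    by_contra! hc
    refine hv2 ⟨?_, ?_, ?_⟩
    · change 1 / 3 ≤ |h (x n + u n + (v + -u n)) - h (x n + u n)|
      rwa [show x n + u n + (v + -u n) = x n + v by ring]
    · linarith [hv.1, hn.2]
    · linarith [hv.2, hn.1]
  change |h (x n + u n) - h (x n)| ≤ 1
  rw [abs_lt] at h3 h4
  rw [abs_le]
  constructor <;> linarith [h3.1, h3.2, h4.1, h4.2]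

theorem eventually_le_exp_mul_natFloor {ℓ : ℝ → ℝ} (hℓ : IsSlowlyVarying ℓ) {r : ℕ → ℝ}
    (hr : Tendsto r atTop atTop) :
    ∀ᶠ n in atTop, ℓ (r n) ≤ Real.exp 1 * ℓ (⌊r n⌋₊ : ℝ) := by
  have hq : Tendsto (fun n => (⌊r n⌋₊ : ℝ)) atTop atTop :=
    tendsto_natCast_atTop_atTop.comp (tendsto_nat_floor_atTop.comp hr)
  have hmem : ∀ᶠ n in atTop, Real.log (r n) - Real.log ⌊r n⌋₊ ∈ Icc (0 : ℝ) 1 := by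
    filter_upwards [hq.eventually_ge_atTop 1, hr.eventually_ge_atTop 1] with n h1 h2
    have h3 := Nat.floor_le (show 0 ≤ r n by linarith)
    have h4 := Nat.lt_floor_add_one (r n)
    refine ⟨sub_nonneg.2 (Real.log_le_log (by linarith) h3), ?_⟩
    rw [← Real.log_div (by linarith) (by linarith), Real.log_le_iff_le_exp (by positivity),
      div_le_iff₀ (by linarith)]
    -- Here `r < ⌊r⌋ + 1 ≤ 2⌊r⌋ ≤ e⌊r⌋`.
    nlinarith [Real.add_one_le_exp (1 : ℝ)]
  filter_upwards [hℓ.eventually_abs_log_sub_le (Real.tendsto_log_atTop.comp hq) hmem,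
    hq.eventually_ge_atTop 1, hr.eventually_ge_atTop 1] with n h1 h2 h3
  simp only [Function.comp, add_sub_cancel] at h1
  rw [Real.exp_log (by linarith), Real.exp_log (by linarith)] at h1
  have h4 := hℓ.pos (r n) (by linarith)
  have h5 := hℓ.pos (⌊r n⌋₊ : ℝ) (by linarith)
  rw [← Real.log_div h4.ne' h5.ne'] at h1
  have h6 := (Real.log_le_iff_le_exp (div_pos h4 h5)).1 (abs_le.1 h1).2
  rwa [div_le_iff₀ h5] at h6

end IsSlowlyVarying

/-! ### Counting visits and the double count -/

section Visits

variable {X : Type*}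

open Classical in
/-- The number of visits of the orbit of `x` to `B` from time `1` to time `n`. -/
noncomputable def visits (T : X → X) (B : Set X) (n : ℕ) (x : X) : ℕ :=
  ((Finset.Icc 1 n).filter fun k => T^[k] x ∈ B).card

theorem occupationTime_eq_visits (T : X → X) (B : Set X) (n : ℕ) (x : X) :
    occupationTime T B n x = visits T B n x := by
  classical
  simp [occupationTime, visits, indicator_apply]

/-- Times up to `j` cost at most `j`; each later visit is a visit of the shifted orbit within its
first `n` steps. -/
theorem visits_le_visits_iterate_add (T : X → X) (B : Set X) (n j : ℕ) (x : X) :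
    visits T B n x ≤ visits T B n (T^[j] x) + j := by
  classical
  have hsub : (Finset.Icc 1 n).filter (fun k => T^[k] x ∈ B) ⊆
      Finset.Icc 1 j ∪
        ((Finset.Icc 1 n).filter fun k => T^[k] (T^[j] x) ∈ B).image (fun k => k + j) := by
    intro k hk
    simp only [Finset.mem_filter, Finset.mem_Icc, Finset.mem_union, Finset.mem_image,
      ← Function.iterate_add_apply] at hk ⊢
    by_cases hkj : k ≤ j
    · exact Or.inl ⟨hk.1.1, hkj⟩
    · refine Or.inr ⟨k - j, ⟨⟨by omega, by omega⟩, ?_⟩, by omega⟩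
      rw [Nat.sub_add_cancel (by omega)]
      exact hk.2
  refine (Finset.card_le_card hsub).trans ((Finset.card_union_le _ _).trans ?_)
  rw [Nat.card_Icc, add_comm]
  exact add_le_add Finset.card_image_le (by simp)

theorem sub_le_card_filter_notMem {T : X → X} {B : Set X} {n p : ℕ} {x : X}
    [DecidablePred fun t => T^[n - t] x ∈ Bᶜ] (h : visits T B n x ≤ p) :
    n - p ≤ ((Finset.range n).filter fun t => T^[n - t] x ∈ Bᶜ).card := by
  classical
  have h1 := Finset.card_filter_add_card_filter_not (s := Finset.Icc 1 n)
    (fun k => T^[k] x ∈ B)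
  rw [Nat.card_Icc] at h1
  have h2 : ((Finset.Icc 1 n).filter fun k => ¬ T^[k] x ∈ B).card ≤
      ((Finset.range n).filter fun t => T^[n - t] x ∈ Bᶜ).card := by
    refine Finset.card_le_card_of_injOn (fun k => n - k) ?_ ?_
    · intro k hk
      simp only [Finset.coe_filter, Finset.mem_Icc, mem_ofPred_eq, Finset.mem_range,
        mem_compl_iff] at hk ⊢
      refine ⟨by omega, ?_⟩
      rw [Nat.sub_sub_self hk.1.2]
      exact hk.2
    · intro a ha b hb hab
      simp only [Finset.coe_filter, Finset.mem_Icc, mem_ofPred_eq] at ha hb hab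
      omega
  unfold visits at h
  omega

/-- All counted times after the earliest one, `t`, are visits to `B` by the orbit of `T^[t] x`
within `n` steps, so there are at most `p` of them; the `+ 1` is `t` itself. -/
theorem card_filter_visits_le (T : X → X) (B : Set X) (n p : ℕ) (x : X)
    [DecidablePred fun t => T^[t] x ∈ B ∩ {y | visits T B n y ≤ p}] :
    ((Finset.range n).filter fun t => T^[t] x ∈ B ∩ {y | visits T B n y ≤ p}).card ≤ p + 1 := by
  classical
  set F := (Finset.range n).filter fun t => T^[t] x ∈ B ∩ {y | visits T B n y ≤ p} with hF
  rcases F.eq_empty_or_nonempty with h | h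
  · simp [h]
  obtain ⟨ht, htB⟩ := Finset.mem_filter.1 (F.min'_mem h)
  set t := F.min' h with htdef
  have hsub : F ⊆ insert t
      (((Finset.Icc 1 n).filter fun k => T^[k] (T^[t] x) ∈ B).image (fun k => k + t)) := by
    intro s hs
    have hts : t ≤ s := F.min'_le s hs
    obtain ⟨hsn, hsB⟩ := Finset.mem_filter.1 hs
    rw [Finset.mem_range] at hsn
    rcases hts.eq_or_lt with rfl | hlt
    · exact Finset.mem_insert_self _ _
    · refine Finset.mem_insert_of_mem (Finset.mem_image.2 ⟨s - t, ?_, by omega⟩)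
      rw [Finset.mem_filter, Finset.mem_Icc, ← Function.iterate_add_apply,
        Nat.sub_add_cancel hts]
      exact ⟨by omega, hsB.1⟩
  refine (Finset.card_le_card hsub).trans ((Finset.card_insert_le _ _).trans ?_)
  exact Nat.succ_le_succ (Finset.card_image_le.trans htB.2)

theorem exists_iterate_mem_of_exit {T : X → X} {Y B : Set X}
    (hTB : ∀ x ∈ B, T x ∉ Y → T x ∈ B) {x : X} {t n : ℕ} (htn : t ≤ n)
    (ht : T^[t] x ∈ B) (hn : T^[n] x ∉ B) : ∃ k ≤ n, T^[k] x ∈ Y := by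
  by_contra! hcon
  refine hn ?_
  suffices ∀ k, t ≤ k → k ≤ n → T^[k] x ∈ B from this n htn le_rfl
  intro k hk
  induction k, hk using Nat.le_induction with
  | base => exact fun _ => ht
  | succ k hk ih =>
    intro hkn
    have := hcon (k + 1) hkn
    rw [Function.iterate_succ_apply'] at this ⊢
    exact hTB _ (ih (by omega)) this

variable [MeasurableSpace X]

theorem measurable_visits {T : X → X} (hT : Measurable T) {B : Set X} (hB : MeasurableSet B)
    (n : ℕ) : Measurable (visits T B n) := by
  classical
  have : visits T B n = fun x => ∑ k ∈ Finset.Icc 1 n, (T^[k] ⁻¹' B).indicator (fun _ => 1) x := by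
    ext x
    simp [visits, indicator_apply]
  rw [this]
  exact Finset.measurable_sum _ fun k _ => measurable_const.indicator (hT.iterate k hB)

theorem measurableSet_visits_le {T : X → X} (hT : Measurable T) {B : Set X}
    (hB : MeasurableSet B) (n p : ℕ) : MeasurableSet {x | visits T B n x ≤ p} :=
  measurable_visits hT hB n measurableSet_Iic

/-- A set `B` which can only be left through `Y` carries few points visiting `B` rarely. -/
theorem sub_mul_measure_visits_le {T : X → X} {μ : Measure X} (hT : MeasurePreserving T μ μ)
    {Y B : Set X} (hY : MeasurableSet Y) (hB : MeasurableSet B)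
    (hTB : ∀ x ∈ B, T x ∉ Y → T x ∈ B) (n p : ℕ) :
    ((n - p : ℕ) : ℝ≥0∞) * μ (B ∩ {x | visits T B n x ≤ p}) ≤
      ((p + 1 : ℕ) : ℝ≥0∞) * μ (⋃ k ∈ Finset.range (n + 1), T^[k] ⁻¹' Y) := by
  classical
  set E := B ∩ {x | visits T B n x ≤ p} with hEdef
  have hE : MeasurableSet E := hB.inter (measurableSet_visits_le hT.measurable hB n p)
  set U := ⋃ k ∈ Finset.range (n + 1), T^[k] ⁻¹' Y with hUdef
  have hU : MeasurableSet U :=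
    Finset.measurableSet_biUnion _ fun k _ => hT.measurable.iterate k hY
  have hD : ∀ k, MeasurableSet (E ∩ T^[k] ⁻¹' Bᶜ) := fun k =>
    hE.inter (hT.measurable.iterate k hB.compl)
  calc ((n - p : ℕ) : ℝ≥0∞) * μ E = ∫⁻ x, E.indicator (fun _ => ((n - p : ℕ) : ℝ≥0∞)) x ∂μ := by
        rw [lintegral_indicator_const hE]
    _ ≤ ∫⁻ x, ∑ t ∈ Finset.range n, (E ∩ T^[n - t] ⁻¹' Bᶜ).indicator 1 x ∂μ := by
        refine lintegral_mono fun x => ?_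
        by_cases hx : x ∈ E
        · have h1 := sub_le_card_filter_notMem (T := T) (B := B) (n := n) hx.2
          rw [indicator_of_mem hx]
          simp only [indicator_apply, mem_inter_iff, hx, true_and, mem_preimage, Pi.one_apply,
            Finset.sum_boole]
          exact_mod_cast h1
        · rw [indicator_of_notMem hx]
          exact zero_le
    _ = ∑ t ∈ Finset.range n, μ (E ∩ T^[n - t] ⁻¹' Bᶜ) := by
        rw [lintegral_finsetSum _ fun t _ => measurable_one.indicator (hD _)]
        exact Finset.sum_congr rfl fun t _ => lintegral_indicator_one (hD _)
    -- Invariance under `T^[t]` moves every time spent outside `B` to the common time `n`, and makes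
    -- the time of being in `E` the variable.
    _ = ∑ t ∈ Finset.range n, μ (T^[t] ⁻¹' E ∩ T^[n] ⁻¹' Bᶜ) := by
        refine Finset.sum_congr rfl fun t ht => ?_
        rw [← (hT.iterate t).measure_preimage (hD _).nullMeasurableSet, preimage_inter,
          ← preimage_comp, ← Function.iterate_add,
          Nat.sub_add_cancel (Finset.mem_range.1 ht).le]
    _ = ∫⁻ x, ∑ t ∈ Finset.range n, (T^[t] ⁻¹' E ∩ T^[n] ⁻¹' Bᶜ).indicator 1 x ∂μ := by
        have hm : ∀ t, MeasurableSet (T^[t] ⁻¹' E ∩ T^[n] ⁻¹' Bᶜ) := fun t =>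
          (hT.measurable.iterate t hE).inter (hT.measurable.iterate n hB.compl)
        rw [lintegral_finsetSum _ fun t _ => measurable_one.indicator (hm t)]
        exact Finset.sum_congr rfl fun t _ => (lintegral_indicator_one (hm t)).symm
    -- A point in `B` at time `t` and outside at time `n` has met `Y` by time `n`, so the sum
    -- vanishes off `U`.
    _ ≤ ∫⁻ x, U.indicator (fun _ => ((p + 1 : ℕ) : ℝ≥0∞)) x ∂μ := by
        refine lintegral_mono fun x => ?_
        by_cases hx : x ∈ U
        · have h1 := card_filter_visits_le T B n p x
          rw [indicator_of_mem hx]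
          refine le_trans (Finset.sum_le_sum fun t _ =>
            indicator_le_indicator_of_subset inter_subset_left (fun _ => zero_le) x) ?_
          simp only [indicator_apply, mem_preimage, Pi.one_apply]
          rw [Finset.sum_boole]
          exact_mod_cast h1
        · refine le_of_eq_of_le (Finset.sum_eq_zero fun t ht => ?_) zero_le
          refine indicator_of_notMem (fun hxt => hx ?_) _
          obtain ⟨k, hk, hkY⟩ := exists_iterate_mem_of_exit hTB (Finset.mem_range.1 ht).le
            hxt.1.1 hxt.2
          simp only [hUdef, mem_iUnion]
          exact ⟨k, Finset.mem_range.2 (by omega), hkY⟩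
    _ = ((p + 1 : ℕ) : ℝ≥0∞) * μ U := lintegral_indicator_const hU _

end Visits

/-! ### Transfer operator and sweeping in integrated form -/

section Transfer

variable {X : Type*} [MeasurableSpace X] {T : X → X} {μ : Measure X}

theorem measurable_transferOperator_iterate {u : X → ℝ≥0∞} (hu : Measurable u) (k : ℕ) :
    Measurable ((transferOperator T μ)^[k] u) := by
  cases k with
  | zero => exact hu
  | succ k =>
    rw [Function.iterate_succ_apply']
    exact Measure.measurable_rnDeriv _ _

/-- Only an inequality, since a Radon–Nikodym derivative loses the singular part; this direction
suffices and avoids absolute continuity. -/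
theorem setLIntegral_transferOperator_iterate_le (hT : Measurable T) (u : X → ℝ≥0∞) (k : ℕ)
    {E : Set X} (hE : MeasurableSet E) :
    ∫⁻ x in E, (transferOperator T μ)^[k] u x ∂μ ≤ ∫⁻ x in T^[k] ⁻¹' E, u x ∂μ := by
  induction k generalizing E with
  | zero => simp
  | succ k ih =>
    rw [Function.iterate_succ_apply']
    refine (Measure.setLIntegral_rnDeriv_le E).trans ?_
    rw [Measure.map_apply hT hE, withDensity_apply _ (hT hE)]
    refine (ih (hT hE)).trans_eq ?_
    rw [← preimage_comp, Function.iterate_succ']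

theorem UniformlySweeping.exists_setLIntegral_le {𝓗 : Set (X → ℝ≥0∞)} {G : X → ℝ≥0∞}
    (h : UniformlySweeping T μ 𝓗 G) (hT : Measurable T) (h𝓗 : ∀ H ∈ 𝓗, Measurable H) :
    ∃ C : ℝ, 0 < C ∧ ∃ K : ℕ, ∀ H ∈ 𝓗, ∀ E, MeasurableSet E →
      ∫⁻ x in E, G x ∂μ ≤
        ENNReal.ofReal C * ∑ k ∈ Finset.range (K + 1), ∫⁻ x in T^[k] ⁻¹' E, H x ∂μ := by
  obtain ⟨C, hC, K, hK⟩ := h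
  refine ⟨C, hC, K, fun H hH E hE => ?_⟩
  refine (lintegral_mono_ae (ae_restrict_of_ae (hK H hH))).trans ?_
  rw [lintegral_const_mul' _ _ ENNReal.ofReal_ne_top, lintegral_finsetSum _
    fun k _ => measurable_transferOperator_iterate (h𝓗 H hH) k]
  exact mul_le_mul_right (Finset.sum_le_sum fun k _ =>
    setLIntegral_transferOperator_iterate_le hT H k hE) _

theorem measurableSet_firstVisit (hT : Measurable T) {Y : Set X} (hY : MeasurableSet Y) (n : ℕ) :
    MeasurableSet (firstVisit T Y n) :=
  (hT.iterate n hY).diff (Finset.measurableSet_biUnion _ fun k _ => hT.iterate k hY)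

theorem pairwise_disjoint_firstVisit {X : Type*} (T : X → X) (Y : Set X) :
    Pairwise (Function.onFun Disjoint (firstVisit T Y)) := by
  rw [pairwise_disjoint_on]
  intro i j hij
  rw [Set.disjoint_left]
  intro x hi hj
  exact hj.2 (mem_biUnion (Finset.mem_coe.2 (Finset.mem_range.2 hij)) hi.1)

theorem measurable_entranceAverage (hT : Measurable T) {Y A : Set X} (hY : MeasurableSet Y)
    (hA : MeasurableSet A) (n : ℕ) : Measurable (entranceAverage T μ Y A n) :=
  (Finset.measurable_fun_sum _ fun k _ => measurable_transferOperator_iterate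
    (measurable_const.indicator ((measurableSet_firstVisit hT hY k).inter hA)) k).const_mul _

/-- The sets of first visit at different times are disjoint, so the `n` summands together cost a
single `μ (A ∩ F)`. -/
theorem setLIntegral_entranceAverage_le (hT : Measurable T) {Y A : Set X} (hY : MeasurableSet Y)
    (hA : MeasurableSet A) (n : ℕ) {E F : Set X} (hE : MeasurableSet E) (hF : MeasurableSet F)
    (hEF : ∀ k < n, T^[k] ⁻¹' E ⊆ F) :
    ∫⁻ x in E, entranceAverage T μ Y A n x ∂μ ≤ (wanderingRate T μ Y A n)⁻¹ * μ (A ∩ F) := by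
  have hm : ∀ k, MeasurableSet (firstVisit T Y k ∩ A) := fun k =>
    (measurableSet_firstVisit hT hY k).inter hA
  have hu : ∀ k, Measurable ((transferOperator T μ)^[k]
      ((firstVisit T Y k ∩ A).indicator fun _ => 1)) := fun k =>
    measurable_transferOperator_iterate (measurable_const.indicator (hm k)) k
  simp only [entranceAverage]
  rw [lintegral_const_mul _ (Finset.measurable_fun_sum _ fun k _ => hu k),
    lintegral_finsetSum _ fun k _ => hu k]
  gcongr
  calc ∑ k ∈ Finset.range n, ∫⁻ x in E, (transferOperator T μ)^[k]
          ((firstVisit T Y k ∩ A).indicator fun _ => 1) x ∂μ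
      ≤ ∑ k ∈ Finset.range n, μ (firstVisit T Y k ∩ (A ∩ F)) := by
        refine Finset.sum_le_sum fun k hk => ?_
        refine (setLIntegral_transferOperator_iterate_le hT _ k hE).trans ?_
        rw [lintegral_indicator_const (hm k), one_mul, Measure.restrict_apply (hm k), inter_assoc]
        exact measure_mono (inter_subset_inter_right _
          (inter_subset_inter_right _ (hEF k (Finset.mem_range.1 hk))))
    _ = μ (⋃ k ∈ Finset.range n, firstVisit T Y k ∩ (A ∩ F)) := by
        refine (measure_biUnion_finset ?_ fun k _ =>
          (measurableSet_firstVisit hT hY k).inter (hA.inter hF)).symm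
        intro i _ j _ hij
        exact (pairwise_disjoint_firstVisit T Y hij).mono inter_subset_left inter_subset_left
    _ ≤ μ (A ∩ F) := measure_mono (iUnion₂_subset fun _ _ => inter_subset_right)

end Transfer

/-! ### Passing from `μ_G` to `μ` on `B`; wandering rates -/

section Bound

variable {X : Type*} [MeasurableSpace X] {T : X → X} {μ : Measure X}

/-- The distribution of the number of visits to `B` under the density `G` is controlled by the one
under `μ` restricted to `B`. -/
theorem exists_withDensity_visits_le {Y A B : Set X} {G : X → ℝ≥0∞} (hT : Measurable T)
    (hY : MeasurableSet Y) (hA : MeasurableSet A) (hB : MeasurableSet B) (hAB : A ⊆ B)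
    {N : ℕ} {𝓗 : Set (X → ℝ≥0∞)} (h𝓗 : ∀ H ∈ 𝓗, Measurable H)
    (hmem : ∀ q, N ≤ q → entranceAverage T μ Y A q ∈ 𝓗)
    (hsweep : UniformlySweeping T μ 𝓗 (Y.indicator fun _ => 1))
    (hG : UniformlySweeping T μ {Y.indicator fun _ => 1} G) :
    ∃ C : ℝ, 0 < C ∧ ∃ K : ℕ, ∀ n p q, N ≤ q →
      μ.withDensity G {x | visits T B n x ≤ p} ≤ ENNReal.ofReal C *
        ((wanderingRate T μ Y A q)⁻¹ * μ (B ∩ {x | visits T B n x ≤ p + K + q})) := by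
  obtain ⟨C₁, hC₁, K₁, h₁⟩ := hG.exists_setLIntegral_le hT (by
    rintro _ rfl
    exact measurable_const.indicator hY)
  obtain ⟨C₂, hC₂, K₂, h₂⟩ := hsweep.exists_setLIntegral_le hT h𝓗
  refine ⟨C₁ * ((K₁ + 1 : ℕ) * (C₂ * (K₂ + 1 : ℕ))), by positivity, K₁ + K₂, fun n p q hq => ?_⟩
  have hS : ∀ r, MeasurableSet {x | visits T B n x ≤ r} := measurableSet_visits_le hT hB n
  rw [withDensity_apply _ (hS p)]
  set R := (wanderingRate T μ Y A q)⁻¹ *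
    μ (B ∩ {x | visits T B n x ≤ p + (K₁ + K₂) + q}) with hR
  have h₃ : ∀ k ∈ Finset.range (K₁ + 1),
      ∫⁻ x in T^[k] ⁻¹' {x | visits T B n x ≤ p}, Y.indicator (fun _ => 1) x ∂μ ≤
        ENNReal.ofReal C₂ * ((K₂ + 1 : ℕ) * R) := by
    intro k hk
    refine (h₂ _ (hmem q hq) _ (hT.iterate k (hS p))).trans (mul_le_mul_right ?_ _)
    refine (Finset.sum_le_card_nsmul _ _ R fun j hj => ?_).trans_eq
      (by rw [Finset.card_range, nsmul_eq_mul])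
    refine (setLIntegral_entranceAverage_le hT hY hA q (hT.iterate j (hT.iterate k (hS p)))
      (hS (p + (K₁ + K₂) + q)) fun i hi x hx => ?_).trans
      (mul_le_mul_right (measure_mono (inter_subset_inter_left _ hAB)) _)
    -- The total shift is `k + j + i` with `k ≤ K₁`, `j ≤ K₂` and `i < q`.
    simp only [mem_preimage, mem_ofPred_eq, ← Function.iterate_add_apply] at hx ⊢
    have := visits_le_visits_iterate_add T B n (k + (j + i)) x
    rw [Finset.mem_range] at hk hj
    omega
  refine (h₁ _ rfl _ (hS p)).trans ?_
  rw [ENNReal.ofReal_mul hC₁.le, ENNReal.ofReal_mul (by positivity), ENNReal.ofReal_mul hC₂.le,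
    ENNReal.ofReal_natCast, ENNReal.ofReal_natCast, mul_assoc, mul_assoc, mul_assoc]
  refine mul_le_mul_right ?_ _
  exact (Finset.sum_le_card_nsmul _ _ _ h₃).trans_eq (by rw [Finset.card_range, nsmul_eq_mul])

theorem measure_iUnion_preimage_ne_top (hT : MeasurePreserving T μ μ) {Y : Set X}
    (hY : MeasurableSet Y) (hYfin : μ Y ≠ ∞) (n : ℕ) :
    μ (⋃ k ∈ Finset.range n, T^[k] ⁻¹' Y) ≠ ∞ := by
  refine ((measure_biUnion_finset_le _ _).trans_lt (ENNReal.sum_lt_top.2 fun k _ => ?_)).ne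
  rw [(hT.iterate k).measure_preimage hY.nullMeasurableSet]
  exact hYfin.lt_top

theorem wanderingRate_ne_top (hT : MeasurePreserving T μ μ) {Y : Set X}
    (hY : MeasurableSet Y) (hYfin : μ Y ≠ ∞) (A : Set X) (n : ℕ) :
    wanderingRate T μ Y A n ≠ ∞ :=
  ne_top_of_le_ne_top (measure_iUnion_preimage_ne_top hT hY hYfin n)
    (measure_mono (iUnion₂_mono fun _ _ => inter_subset_left))

theorem wanderingRate_mono (T : X → X) (μ : Measure X) (Y A : Set X) :
    Monotone (wanderingRate T μ Y A) := fun _ _ h =>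
  measure_mono (biUnion_mono (fun _ hk => Finset.range_mono h hk) fun _ _ => subset_rfl)

/-- One `μ Y` pays for shortening the window from `n + 1` to `n` by invariance, the other for the
points of `Y` itself. -/
theorem measure_iUnion_preimage_succ_le (hT : MeasurePreserving T μ μ) {ι : Type*} [Fintype ι]
    {Y : Set X} {A : ι → Set X} (hY : MeasurableSet Y) (hcover : Y ∪ ⋃ i, A i = univ) (n : ℕ) :
    μ (⋃ k ∈ Finset.range (n + 1), T^[k] ⁻¹' Y) ≤
      2 * μ Y + ∑ i, wanderingRate T μ Y (A i) n := by
  have hU : MeasurableSet (⋃ k ∈ Finset.range n, T^[k] ⁻¹' Y) :=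
    Finset.measurableSet_biUnion _ fun k _ => hT.measurable.iterate k hY
  have h1 : (⋃ k ∈ Finset.range (n + 1), T^[k] ⁻¹' Y) ⊆
      Y ∪ T ⁻¹' ⋃ k ∈ Finset.range n, T^[k] ⁻¹' Y := by
    refine iUnion₂_subset fun k hk x hx => ?_
    cases k with
    | zero => exact Or.inl hx
    | succ k =>
      refine Or.inr (mem_biUnion (Finset.mem_coe.2 (Finset.mem_range.2 ?_)) hx)
      have := Finset.mem_range.1 hk
      omega
  have h2 : (⋃ k ∈ Finset.range n, T^[k] ⁻¹' Y) ⊆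
      Y ∪ ⋃ i, ⋃ k ∈ Finset.range n, (T^[k] ⁻¹' Y) ∩ A i := by
    refine iUnion₂_subset fun k hk x hx => ?_
    rcases hcover.ge (mem_univ x) with h | h
    · exact Or.inl h
    · obtain ⟨i, hi⟩ := mem_iUnion.1 h
      exact Or.inr (mem_iUnion.2 ⟨i, mem_biUnion (Finset.mem_coe.2 hk) ⟨hx, hi⟩⟩)
  calc μ (⋃ k ∈ Finset.range (n + 1), T^[k] ⁻¹' Y)
      ≤ μ Y + μ (⋃ k ∈ Finset.range n, T^[k] ⁻¹' Y) := by
        refine (measure_mono h1).trans ((measure_union_le _ _).trans_eq ?_)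
        rw [hT.measure_preimage hU.nullMeasurableSet]
    _ ≤ μ Y + (μ Y + ∑ i, wanderingRate T μ Y (A i) n) := by
        gcongr
        exact (measure_mono h2).trans ((measure_union_le _ _).trans
          (add_le_add le_rfl (measure_iUnion_fintype_le _ _)))
    _ = 2 * μ Y + ∑ i, wanderingRate T μ Y (A i) n := by rw [two_mul, add_assoc]

end Bound

/-! ### From weighted occupation times to visits -/

section Visits

variable {X : Type*}

theorem visits_iUnion_le {ι : Type*} [Fintype ι] (T : X → X) (A : ι → Set X) (n : ℕ) (x : X) :
    visits T (⋃ i, A i) n x ≤ ∑ i, visits T (A i) n x := by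
  classical
  refine le_trans (Finset.card_le_card ?_) Finset.card_biUnion_le
  intro k hk
  simp only [Finset.mem_filter, mem_iUnion, Finset.mem_biUnion, Finset.mem_univ, true_and] at hk ⊢
  obtain ⟨hk, i, hi⟩ := hk
  exact ⟨i, hk, hi⟩

theorem visits_iUnion_le_floor_div {ι : Type*} [Fintype ι] {T : X → X} {A : ι → Set X}
    {lam : ι → ℝ} {δ : ℝ} (hδ : 0 < δ) (hlam : ∀ i, δ ≤ lam i) {n : ℕ} (hn : 0 < n) {c : ℝ} {x : X}
    (hx : (1 / (n : ℝ)) * ∑ i, lam i * occupationTime T (A i) n x ≤ c) :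
    visits T (⋃ i, A i) n x ≤ ⌊c * n / δ⌋₊ := by
  have hn' : (0 : ℝ) < n := by exact_mod_cast hn
  rw [one_div_mul_eq_div, div_le_iff₀ hn'] at hx
  refine Nat.le_floor ((le_div_iff₀ hδ).2 (le_trans ?_ hx))
  simp only [occupationTime_eq_visits]
  calc (visits T (⋃ i, A i) n x : ℝ) * δ ≤ (∑ i, (visits T (A i) n x : ℝ)) * δ := by
        gcongr
        exact_mod_cast visits_iUnion_le T A n x
    _ = ∑ i, δ * visits T (A i) n x := by rw [mul_comm, Finset.mul_sum]
    _ ≤ ∑ i, lam i * visits T (A i) n x := by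
        gcongr with i
        exact hlam i

end Visits

/-! ### Asymptotic estimates -/

section Asymptotic

theorem eventually_half_le_and_le_two_mul {u v : ℕ → ℝ} (h : u ~[atTop] v)
    (hv : ∀ᶠ n in atTop, 0 < v n) : ∀ᶠ n in atTop, v n / 2 ≤ u n ∧ u n ≤ 2 * v n := by
  obtain ⟨φ, hφ, hu⟩ := h.exists_eq_mul
  filter_upwards [hu, hv, hφ.eventually (Icc_mem_nhds (show (1 / 2 : ℝ) < 1 by norm_num)
    (show (1 : ℝ) < 2 by norm_num))] with n h1 h2 h3
  rw [h1, Pi.mul_apply]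
  constructor <;> nlinarith [h3.1, h3.2]

theorem IsSlowlyVarying.eventually_rpow_mul_pos {ℓ : ℝ → ℝ} (hℓ : IsSlowlyVarying ℓ) (s : ℝ) :
    ∀ᶠ n : ℕ in atTop, 0 < (n : ℝ) ^ s * ℓ n := by
  filter_upwards [eventually_gt_atTop 0] with n hn
  have : (0 : ℝ) < n := by exact_mod_cast hn
  exact mul_pos (Real.rpow_pos_of_pos this _) (hℓ.pos _ this)

variable {X : Type*} [MeasurableSpace X] {T : X → X} {μ : Measure X}

theorem eventually_ofReal_le_wanderingRate {Y A : Set X} {ℓ : ℝ → ℝ} (hℓ : IsSlowlyVarying ℓ)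
    {s b : ℝ} (hb : 0 < b)
    (hw : (fun n : ℕ => (wanderingRate T μ Y A n).toReal) ~[atTop]
      (fun n : ℕ => b * (n : ℝ) ^ s * ℓ n)) :
    ∀ᶠ n : ℕ in atTop, ENNReal.ofReal (b / 2 * ((n : ℝ) ^ s * ℓ n)) ≤ wanderingRate T μ Y A n := by
  filter_upwards [eventually_half_le_and_le_two_mul hw
    ((hℓ.eventually_rpow_mul_pos s).mono fun n hn => by rw [mul_assoc]; positivity)] with n hn
  refine ENNReal.ofReal_le_of_le_toReal (le_trans (le_of_eq ?_) hn.1)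
  ring

theorem exists_measure_iUnion_preimage_le (hT : MeasurePreserving T μ μ) {ι : Type*} [Fintype ι]
    [Nonempty ι] {Y : Set X} {A : ι → Set X} (hY : MeasurableSet Y) (hYfin : μ Y ≠ ∞)
    (hcover : Y ∪ ⋃ i, A i = univ) {ℓ : ℝ → ℝ} (hℓ : IsSlowlyVarying ℓ) {s : ℝ} {β : ι → ℝ}
    (hβ : ∀ i, 0 < β i)
    (hw : ∀ i, (fun n : ℕ => (wanderingRate T μ Y (A i) n).toReal) ~[atTop]
      (fun n : ℕ => β i * (n : ℝ) ^ s * ℓ n)) :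
    ∃ b : ℝ, 0 < b ∧ ∀ᶠ n : ℕ in atTop,
      μ (⋃ k ∈ Finset.range (n + 1), T^[k] ⁻¹' Y) ≤ ENNReal.ofReal (b * ((n : ℝ) ^ s * ℓ n)) := by
  have hpos := hℓ.eventually_rpow_mul_pos s
  have hbd : ∀ i, ∀ᶠ n : ℕ in atTop, β i * (n : ℝ) ^ s * ℓ n / 2 ≤
      (wanderingRate T μ Y (A i) n).toReal ∧
      (wanderingRate T μ Y (A i) n).toReal ≤ 2 * (β i * (n : ℝ) ^ s * ℓ n) := fun i =>
    eventually_half_le_and_le_two_mul (hw i)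
      (hpos.mono fun n hn => by have := hβ i; rw [mul_assoc]; positivity)
  obtain ⟨i₀⟩ := ‹Nonempty ι›
  obtain ⟨n₀, hn₀, hn₀'⟩ := ((hbd i₀).and hpos).exists
  set δ := (wanderingRate T μ Y (A i₀) n₀).toReal
  have hδ : 0 < δ := lt_of_lt_of_le (by have := hβ i₀; rw [mul_assoc]; positivity) hn₀.1
  have hβs : 0 < ∑ i, β i := Finset.sum_pos (fun i _ => hβ i) ⟨i₀, Finset.mem_univ _⟩
  refine ⟨2 * ((μ Y).toReal / δ * (2 * β i₀)) + 2 * ∑ i, β i,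
    by have := hβ i₀; positivity, ?_⟩
  filter_upwards [eventually_all.2 hbd, hpos, eventually_ge_atTop n₀] with n h1 h2 h3
  refine (measure_iUnion_preimage_succ_le hT hY hcover n).trans ?_
  have hfin := fun i => wanderingRate_ne_top hT hY hYfin (A i) n
  -- Monotonicity of the wandering rate keeps `n ^ s * ℓ n` away from zero, so the constant `μ Y`
  -- can be absorbed.
  have hle : δ ≤ 2 * β i₀ * ((n : ℝ) ^ s * ℓ n) := by
    refine (ENNReal.toReal_mono (hfin i₀) (wanderingRate_mono T μ Y (A i₀) h3)).trans
      ((h1 i₀).2.trans_eq ?_)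
    ring
  have hsum : ∑ i, (wanderingRate T μ Y (A i) n).toReal ≤
      2 * (∑ i, β i) * ((n : ℝ) ^ s * ℓ n) := by
    rw [Finset.mul_sum, Finset.sum_mul]
    refine Finset.sum_le_sum fun i _ => (h1 i).2.trans_eq ?_
    ring
  have hY' : (μ Y).toReal ≤ (μ Y).toReal / δ * (2 * β i₀) * ((n : ℝ) ^ s * ℓ n) := by
    calc (μ Y).toReal = (μ Y).toReal / δ * δ := by field_simp
      _ ≤ (μ Y).toReal / δ * (2 * β i₀ * ((n : ℝ) ^ s * ℓ n)) := by gcongr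
      _ = _ := by ring
  have htop : 2 * μ Y + ∑ i, wanderingRate T μ Y (A i) n ≠ ∞ :=
    ENNReal.add_ne_top.2 ⟨ENNReal.mul_ne_top (by simp) hYfin,
      (ENNReal.sum_lt_top.2 fun i _ => (hfin i).lt_top).ne⟩
  refine ENNReal.le_ofReal_iff_toReal_le htop (by have := hβ i₀; positivity) |>.2 ?_
  rw [ENNReal.toReal_add (ENNReal.mul_ne_top (by simp) hYfin)
    (ENNReal.sum_lt_top.2 fun i _ => (hfin i).lt_top).ne, ENNReal.toReal_mul,
    ENNReal.toReal_sum fun i _ => hfin i, ENNReal.toReal_ofNat]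
  linarith

/-- Writing `c = c^α · c^(1-α)` cancels the rate. Replacing `c n` by `q` costs at most `2` in the
power and `e` in the slowly varying factor, whence `4e` with the `2` already present. -/
theorem rate_mul_le {c n q ℓr ℓn ℓq α a b D C : ℝ} (hc : 0 < c) (hn : 0 < n) (hq : 0 < q)
    (hℓn : 0 < ℓn) (hℓq : 0 < ℓq) (hℓr : 0 < ℓr) (ha : 0 < a) (hb : 0 < b) (hD : 0 < D)
    (hC : 0 < C) (hα : α ∈ Ioo (0 : ℝ) 1) (hqc : c * n ≤ 2 * q) (hℓ : ℓr ≤ Real.exp 1 * ℓq) :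
    ℓr / (c ^ α * ℓn) * (C * ((a * (q ^ (1 - α) * ℓq))⁻¹ *
      (2 * D * c * (b * (n ^ (1 - α) * ℓn))))) ≤ 4 * Real.exp 1 * C * D * b / a := by
  have h1 : (c * n) ^ (1 - α) ≤ 2 * q ^ (1 - α) := by
    refine (Real.rpow_le_rpow (by positivity) hqc (by linarith [hα.2])).trans ?_
    rw [Real.mul_rpow (by norm_num) hq.le]
    gcongr
    exact (Real.rpow_le_rpow_of_exponent_le (by norm_num) (by linarith [hα.1])).trans_eq
      (Real.rpow_one 2)
  have hcα : c = c ^ α * c ^ (1 - α) := by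
    rw [← Real.rpow_add hc]
    simp
  have hcp : 0 < c ^ α := Real.rpow_pos_of_pos hc _
  have hqp : 0 < q ^ (1 - α) := Real.rpow_pos_of_pos hq _
  calc ℓr / (c ^ α * ℓn) * (C * ((a * (q ^ (1 - α) * ℓq))⁻¹ *
        (2 * D * c * (b * (n ^ (1 - α) * ℓn)))))
      = 2 * C * D * b / a * ((ℓr / ℓq) * ((c * n) ^ (1 - α) / q ^ (1 - α))) := by
        rw [Real.mul_rpow hc.le hn.le]
        nth_rw 2 [hcα]
        field_simp
    _ ≤ 2 * C * D * b / a * (Real.exp 1 * 2) := by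
        have h2 : ℓr / ℓq ≤ Real.exp 1 := (div_le_iff₀ hℓq).2 hℓ
        have h3 : (c * n) ^ (1 - α) / q ^ (1 - α) ≤ 2 := (div_le_iff₀ hqp).2 h1
        gcongr
    _ = 4 * Real.exp 1 * C * D * b / a := by ring

theorem le_ofReal_of_sub_mul_le {n p : ℕ} {x W : ℝ≥0∞} {c D w : ℝ} (hn : 0 < n) (hw : 0 ≤ w)
    (hp : (p + 1 : ℝ) ≤ D * (c * n)) (hpn : 2 * p ≤ n)
    (h : ((n - p : ℕ) : ℝ≥0∞) * x ≤ ((p + 1 : ℕ) : ℝ≥0∞) * W) (hW : W ≤ ENNReal.ofReal w) :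
    x ≤ ENNReal.ofReal (2 * D * c * w) := by
  have hn' : (0 : ℝ) < n := by exact_mod_cast hn
  have hhalf : (n : ℝ) / 2 ≤ ((n - p : ℕ) : ℝ) := by
    rw [Nat.cast_sub (by omega)]
    have : (2 * p : ℝ) ≤ n := by exact_mod_cast hpn
    linarith
  have h1 : ENNReal.ofReal (n / 2) * x ≤ ENNReal.ofReal (n / 2) * ENNReal.ofReal (2 * D * c * w) :=
    calc ENNReal.ofReal (n / 2) * x ≤ ((n - p : ℕ) : ℝ≥0∞) * x := by
          gcongr
          rw [← ENNReal.ofReal_natCast]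
          exact ENNReal.ofReal_le_ofReal hhalf
      _ ≤ ((p + 1 : ℕ) : ℝ≥0∞) * ENNReal.ofReal w := h.trans (by gcongr)
      _ = ENNReal.ofReal ((p + 1 : ℝ) * w) := by
          rw [← ENNReal.ofReal_natCast, ← ENNReal.ofReal_mul (by positivity), Nat.cast_succ]
      _ ≤ ENNReal.ofReal (D * (c * n) * w) := ENNReal.ofReal_le_ofReal (by gcongr)
      _ = ENNReal.ofReal (n / 2) * ENNReal.ofReal (2 * D * c * w) := by
          rw [← ENNReal.ofReal_mul (by positivity)]
          congr 1
          ring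
  exact (ENNReal.mul_le_mul_iff_right (by simpa using hn) ENNReal.ofReal_ne_top).1 h1

end Asymptotic

/-! ### The main theorem -/

theorem mainTheorem5 {X : Type*} [MeasurableSpace X] (μ : Measure X) [SigmaFinite μ]
    (T : X → X) (hTc : Conservative T μ) (hTe : Ergodic T μ)
    -- the sets `A_1, …, A_d` are `A 0, …, A (Fin.last m)`, with `d = m + 1 ≥ 2`
    (m : ℕ) (hm : 1 ≤ m) (Y : Set X) (A : Fin (m + 1) → Set X)
    (hYmeas : MeasurableSet Y) (hAmeas : ∀ i, MeasurableSet (A i))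
    (hYA : ∀ i, Disjoint Y (A i)) (hAA : ∀ i j, i ≠ j → Disjoint (A i) (A j))
    (hcover : Y ∪ ⋃ i, A i = univ)
    (hYpos : 0 < μ Y) (hYfin : μ Y < ∞) (hAinf : ∀ i, μ (A i) = ∞)
    (hsep : DynamicallySeparates T A)
    -- regular variation of the wandering rates
    (α : ℝ) (hα : α ∈ Ioo (0 : ℝ) 1)
    (β : Fin (m + 1) → ℝ) (hβ : ∀ i, β i ∈ Ioo (0 : ℝ) 1) (hβsum : ∑ i, β i = 1)
    (ℓ : ℝ → ℝ) (hℓ : IsSlowlyVarying ℓ)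
    (hw : ∀ i, (fun n : ℕ => (wanderingRate T μ Y (A i) n).toReal) ~[atTop]
      (fun n : ℕ => β i * (n : ℝ) ^ (1 - α) * ℓ n))
    -- boundedness in `L^∞(μ)` of the averages for `A_d`
    (hbdd : ∃ M : ℝ, ∀ n : ℕ, 2 ≤ n →
      ∀ᵐ x ∂μ, entranceAverage T μ Y (A (Fin.last m)) n x ≤ ENNReal.ofReal M)
    -- uniform sweeping of the averages for `A_1, …, A_{d-1}`
    (hsweep : ∃ N : ℕ, 2 ≤ N ∧ UniformlySweeping T μ
      {H | ∃ n : ℕ, N ≤ n ∧ ∃ i : Fin m, H = entranceAverage T μ Y (A i.castSucc) n}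
      (Y.indicator (fun _ => 1)))
    (G : X → ℝ) (hGint : Integrable G μ) (hGnonneg : ∀ᵐ x ∂μ, 0 ≤ G x)
    (hGsweep : UniformlySweeping T μ {Y.indicator (fun _ => 1)}
      (fun x => ENNReal.ofReal (G x)))
    (lam : Fin m → ℝ) (hlam : ∀ i, 0 < lam i) :
    ∃ C₂ : ℝ, 0 < C₂ ∧ ∀ c : ℕ → ℝ, (∀ n, 0 < c n) → Tendsto c atTop (𝓝 0) →
      Tendsto (fun n : ℕ => c n * (n : ℝ)) atTop atTop →
      limsup (fun n : ℕ =>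
        ENNReal.ofReal (ℓ (c n * (n : ℝ)) / (c n ^ α * ℓ n)) *
          (μ.withDensity fun x => ENNReal.ofReal (G x))
            {x | (1 / (n : ℝ)) * ∑ i : Fin m, lam i * occupationTime T (A i.castSucc) n x ≤ c n})
        atTop ≤ ENNReal.ofReal C₂ := by
  have hT : MeasurePreserving T μ μ := hTe.toMeasurePreserving
  have : Nonempty (Fin m) := ⟨⟨0, hm⟩⟩
  obtain ⟨i₀, hi₀⟩ := Finite.exists_min lam
  set δ := lam i₀
  have hδ : 0 < δ := hlam i₀
  set B : Set X := ⋃ i : Fin m, A i.castSucc with hBdef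
  have hB : MeasurableSet B := MeasurableSet.iUnion fun i => hAmeas _
  have hTB : ∀ x ∈ B, T x ∉ Y → T x ∈ B := by
    intro x hx hTx
    obtain ⟨i, hi⟩ := mem_iUnion.1 hx
    obtain ⟨j, hj⟩ := mem_iUnion.1 ((hcover.ge (mem_univ (T x))).resolve_left hTx)
    by_cases hij : i.castSucc = j
    · exact mem_iUnion.2 ⟨i, hij ▸ hj⟩
    · exact ((hsep _ _ hij).le ⟨hi, hj⟩).elim
  obtain ⟨N, -, hsweep⟩ := hsweep
  obtain ⟨C, hC, K, hCK⟩ := exists_withDensity_visits_le (A := A i₀.castSucc) (N := N)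
    (𝓗 := {H | ∃ n : ℕ, N ≤ n ∧ ∃ i : Fin m, H = entranceAverage T μ Y (A i.castSucc) n})
    hT.measurable hYmeas (hAmeas _) hB
    (subset_iUnion (fun i : Fin m => A i.castSucc) i₀)
    (by rintro _ ⟨n, -, i, rfl⟩
        exact measurable_entranceAverage hT.measurable hYmeas (hAmeas _) n)
    (fun q hq => ⟨q, hq, i₀, rfl⟩) hsweep hGsweep
  obtain ⟨b, hb, hW⟩ := exists_measure_iUnion_preimage_le hT hYmeas hYfin.ne hcover hℓ
    (fun i => (hβ i).1) hw
  have hβ₀ := (hβ i₀.castSucc).1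
  have hwlow := eventually_ofReal_le_wanderingRate hℓ hβ₀ (hw i₀.castSucc)
  set a := β i₀.castSucc / 2
  have ha : 0 < a := half_pos hβ₀
  -- Chosen so that `p + K + q + 1 ≤ D r`, with `r = c n * n`: `p ≤ r / δ`, `q ≤ r` and eventually
  -- `K + 1 ≤ r`.
  set D := 1 / δ + 2 with hDdef
  have hD : 0 < D := by positivity
  refine ⟨4 * Real.exp 1 * C * D * b / a, by positivity, fun c hc hc0 hcn => ?_⟩
  have hfloor : Tendsto (fun n : ℕ => ⌊c n * n⌋₊) atTop atTop :=
    tendsto_nat_floor_atTop.comp hcn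
  refine limsup_le_of_le (by isBoundedDefault) ?_
  filter_upwards [eventually_gt_atTop 0, hW, hfloor.eventually hwlow,
    hfloor.eventually_ge_atTop (N + 1), hℓ.eventually_le_exp_mul_natFloor hcn,
    hcn.eventually_ge_atTop (K + 1 : ℝ),
    -- This makes `p + K + q ≤ n / 2`, so the factor `n - (p + K + q)` in the double count is at
    -- least `n / 2`.
    hc0.eventually_le_const (show (0 : ℝ) < 1 / (2 * D) by positivity)]
    with n hn hWn hwq hqN hℓq hKr hcD
  set r := c n * (n : ℝ) with hr
  set q := ⌊r⌋₊
  set p := ⌊r / δ⌋₊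
  have hn' : (0 : ℝ) < n := by exact_mod_cast hn
  have hrpos : 0 < r := mul_pos (hc n) hn'
  have hq1 : (1 : ℝ) ≤ q := by exact_mod_cast (by omega : 1 ≤ q)
  have hqr : (q : ℝ) ≤ r := Nat.floor_le hrpos.le
  have hrq : r < q + 1 := Nat.lt_floor_add_one r
  have hpr : (p : ℝ) ≤ r / δ := Nat.floor_le (by positivity)
  have hpD : (((p + K + q : ℕ) : ℝ) + 1) ≤ D * (c n * n) := by
    rw [← hr, hDdef, add_mul, one_div_mul_eq_div]
    push_cast
    linarith
  have hpn : 2 * (p + K + q) ≤ n := by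
    have h1 : D * (c n * n) ≤ n / 2 := by
      calc D * (c n * n) ≤ D * (1 / (2 * D) * n) := by gcongr
        _ = n / 2 := by field_simp
    have h2 : (2 * ((p + K + q : ℕ) : ℝ)) ≤ n := by linarith
    exact_mod_cast h2
  have hEbound := le_ofReal_of_sub_mul_le hn
    (mul_nonneg hb.le (mul_nonneg (by positivity) (hℓ.pos _ hn').le)) hpD hpn
    (sub_mul_measure_visits_le hT hYmeas hB hTB n (p + K + q)) hWn
  have hℓqpos : 0 < ℓ q := hℓ.pos _ (by linarith)
  have hgq : 0 < a * ((q : ℝ) ^ (1 - α) * ℓ q) :=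
    mul_pos ha (mul_pos (Real.rpow_pos_of_pos (by linarith) _) hℓqpos)
  calc _ ≤ ENNReal.ofReal (ℓ r / (c n ^ α * ℓ n)) * (ENNReal.ofReal C *
        (ENNReal.ofReal (a * ((q : ℝ) ^ (1 - α) * ℓ q))⁻¹ *
          ENNReal.ofReal (2 * D * c n * (b * ((n : ℝ) ^ (1 - α) * ℓ n))))) := by
        refine mul_le_mul_right (((measure_mono fun x hx => ?_).trans
          (hCK n p q (by omega))).trans (mul_le_mul_right (mul_le_mul' ?_ hEbound) _)) _
        · exact visits_iUnion_le_floor_div hδ hi₀ hn hx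
        · rw [ENNReal.ofReal_inv_of_pos hgq]
          exact ENNReal.inv_le_inv.2 hwq
    _ = ENNReal.ofReal (ℓ r / (c n ^ α * ℓ n) * (C * ((a * ((q : ℝ) ^ (1 - α) * ℓ q))⁻¹ *
          (2 * D * c n * (b * ((n : ℝ) ^ (1 - α) * ℓ n)))))) := by
        have h1 := hc n
        have h2 := hℓ.pos _ hn'
        have h3 := hℓ.pos _ hrpos
        rw [← ENNReal.ofReal_mul (inv_pos.2 hgq).le, ← ENNReal.ofReal_mul hC.le,
          ← ENNReal.ofReal_mul (by positivity)]
    _ ≤ _ := ENNReal.ofReal_le_ofReal (rate_mul_le (hc n) hn' (by linarith) (hℓ.pos _ hn') hℓqpos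
        (hℓ.pos _ hrpos) ha hb hD hC hα (by linarith) hℓq)
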